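/- Let $\lambda$ be a Young diagram, drawn with left-justified rows stacked upwards (French convention), so that the box in row $r$ and column $c$ has coordinates $(x,y)=(c,r)$. The dimension $\dim\mu$ of a Young diagram $\mu$ is the number of standard Young tableaux of shape $\mu$. Let $\lambda_{\mathrm{sym}}$ be the largest subdiagram of $\lambda$ that is symmetric with respect to the line $y=x$, let $A=\lambda\setminus\lambda_{\mathrm{sym}}$ be the set of boxes of $\lambda$ outside it, and suppose that each row and each column of $\lambda$ contains at most one box of $A$. Let $A_u$ and $A_d$ be the sets of boxes of $A$ lying above, respectively below, the line $y=x$, and let $\widetilde{A_d}$ be the reflection of $A_d$ in this line. Then $\lambda'=\lambda_{\mathrm{sym}}\cup A_u\cup\widetilde{A_d}$ is a Young diagram with the same number of boxes as $\lambda$, and $\dim\lambda'\ge\dim\lambda$. If $A_u$ and $A_d$ are both nonempty, then $\dim\lambda'>\dim\lambda$. -/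

import Mathlib

namespace YoungDiagram

/-- A Young diagram that is invariant under reflection in the main diagonal. -/
def IsSymmetric (μ : YoungDiagram) : Prop :=
  μ.transpose = μ

/-- The base subdiagram: the largest symmetric subdiagram
(see `isGreatest_baseSubdiagram`). -/
def baseSubdiagram (μ : YoungDiagram) : YoungDiagram :=
  μ ⊓ μ.transpose

theorem isGreatest_baseSubdiagram (μ : YoungDiagram) :
    IsGreatest {ν : YoungDiagram | ν.IsSymmetric ∧ ν ≤ μ} μ.baseSubdiagram := by
  refine ⟨⟨?_, inf_le_left⟩, ?_⟩
  · unfold IsSymmetric baseSubdiagram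
    ext c
    simp only [mem_cells, mem_transpose, mem_inf, Prod.swap_swap]
    exact and_comm
  · rintro ν ⟨hs, hle⟩
    refine le_inf hle ?_
    have h := YoungDiagram.transpose_mono hle
    rwa [show ν.transpose = ν from hs] at h

/-- The boxes of `μ` outside its base subdiagram. -/
def asymBoxes (μ : YoungDiagram) : Finset (ℕ × ℕ) :=
  μ.cells \ μ.baseSubdiagram.cells

/-- The boxes outside the base subdiagram that lie above the line `y = x`. A cell `c` lies in row
`c.1` and column `c.2`; with rows stacked upwards, its `x`-coordinate is `c.2` and its
`y`-coordinate is `c.1`. -/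
def asymAbove (μ : YoungDiagram) : Finset (ℕ × ℕ) :=
  μ.asymBoxes.filter fun c => c.2 < c.1

/-- The boxes outside the base subdiagram that lie below the line `y = x`. -/
def asymBelow (μ : YoungDiagram) : Finset (ℕ × ℕ) :=
  μ.asymBoxes.filter fun c => c.1 < c.2

/-- A standard Young tableau of shape `μ`: a filling of the `n` boxes of `μ` by the numbers
`1, …, n`, each used exactly once, that increases along rows and columns. -/
structure StandardTableau (μ : YoungDiagram) where
  entry : μ.cells ≃ Finset.Icc 1 μ.card
  row_lt : ∀ c d : μ.cells, c.1.1 = d.1.1 → c.1.2 < d.1.2 → entry c < entry d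
  col_lt : ∀ c d : μ.cells, c.1.2 = d.1.2 → c.1.1 < d.1.1 → entry c < entry d

/-- The dimension of a Young diagram: the number of its standard Young tableaux. -/
noncomputable def dim (μ : YoungDiagram) : ℕ :=
  Nat.card μ.StandardTableau

/-- There are finitely many standard tableaux of a given shape, so that `dim` counts them. -/
instance (μ : YoungDiagram) : Finite μ.StandardTableau :=
  Finite.of_injective (fun T => T.entry) fun S T h => by
    cases S
    cases T
    cases h
    rfl

end YoungDiagram

/-!
By the hook length formula it suffices to compare products of hook lengths. Let `σ` be the base
subdiagram, `U` the set of added boxes above the diagonal and `V` the reflection of those below it.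
When a set `B` of boxes, at most one in each row and column, is added to `σ`, the hook length of a
cell of `σ` grows by the number of boxes of `B` in its row and in its column. Multiplying the
factors of a cell `(i, j)` and of its mirror image, one finds that the products for `σ ∪ (U ∪ V)`
and for the original diagram differ by `-(u i - u j) * (v i - v j)`, where `u` and `v` are the
differences of the row and column counts of `U` and `V`. So only cells whose row and column meet a
box of `U` and a box of `V` matter. They come in couples: for two such boxes `k` and `l` with
`l.2 < k.2`, let `h` and `g` be the hook lengths in `σ` of the cells `(k.1, l.2)` and `(k.2, l.2)`.
Then the factor `(h + 1) ^ 2 * (g * (g + 2))` of the original diagram becomes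
`h * (h + 2) * (g + 1) ^ 2`, which is smaller because `h < g`.

The hook length formula follows from the branching rule: removing a corner changes the hook product
by a ratio that is rational in the beta numbers, and the sum of these ratios over all rows is
evaluated by Lagrange interpolation.
-/

namespace YoungTableaux

open Finset YoungDiagram

section Interpolation

open Polynomial

variable {ι : Type*}

/-- The polynomial `X P(X - 1) - X P(X) + n P(X)`, where `P` is the monic polynomial with the
`n` roots `x i`, `i ∈ s`. Its leading terms cancel, and at the node `x i` it takes the value
`-x i * ∏ j ∈ s.erase i, (x i - 1 - x j)`, so Lagrange interpolation evaluates sums of such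
products. -/
noncomputable def shiftRemainder {R : Type*} [CommRing R] (s : Finset ι) (x : ι → R) : R[X] :=
  X * Lagrange.nodal s (fun i => x i + 1) - X * Lagrange.nodal s x + C (#s : R) * Lagrange.nodal s x

section CommRing

variable {R : Type*} [CommRing R]

theorem shiftRemainder_insert [DecidableEq ι] {s : Finset ι} {a : ι} (ha : a ∉ s) (x : ι → R) :
    shiftRemainder (insert a s) x =
      X * shiftRemainder s x - C (x a + 1) * shiftRemainder s x +
        C ((#s : R) - x a) * Lagrange.nodal s x := by
  simp only [shiftRemainder, Lagrange.nodal_insert_eq_nodal ha, card_insert_of_notMem ha,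
    map_add, map_sub, map_natCast, map_one, Nat.cast_add, Nat.cast_one]
  ring

theorem degree_shiftRemainder_lt [Nontrivial R] (s : Finset ι) (x : ι → R) :
    (shiftRemainder s x).degree < #s := by
  classical
  induction s using Finset.induction_on with
  | empty => simp [shiftRemainder]
  | insert a s ha ih =>
    rw [degree_lt_iff_coeff_zero] at ih
    rw [shiftRemainder_insert ha, card_insert_of_notMem ha, degree_lt_iff_coeff_zero]
    rintro (_ | m) hm
    · omega
    have hnodal : (Lagrange.nodal s x).coeff (m + 1) = 0 :=
      coeff_eq_zero_of_natDegree_lt (by rw [Lagrange.natDegree_nodal]; omega)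
    simp only [coeff_add, coeff_sub, coeff_X_mul, coeff_C_mul, ih m (by omega),
      ih (m + 1) (by omega), hnodal, mul_zero, sub_zero, add_zero]

theorem coeff_card_X_mul_shiftRemainder [Nontrivial R] (s : Finset ι) (x : ι → R) :
    (X * shiftRemainder s x).coeff #s = ((#s).choose 2 : R) - ∑ i ∈ s, x i := by
  classical
  induction s using Finset.induction_on with
  | empty => simp [shiftRemainder]
  | insert a s ha ih =>
    have hnodal : (Lagrange.nodal s x).coeff #s = 1 := by
      simpa only [Lagrange.natDegree_nodal] using
        (Lagrange.nodal_monic (s := s) (v := x)).coeff_natDegree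
    rw [shiftRemainder_insert ha, card_insert_of_notMem ha, coeff_X_mul, coeff_add, coeff_sub, ih,
      coeff_C_mul, coeff_C_mul, hnodal, coeff_eq_zero_of_degree_lt (degree_shiftRemainder_lt s x),
      sum_insert ha, Nat.choose_succ_succ' _ 1, Nat.choose_one_right]
    push_cast
    ring

theorem eval_shiftRemainder [DecidableEq ι] {s : Finset ι} {i : ι} (hi : i ∈ s) (x : ι → R) :
    (shiftRemainder s x).eval (x i) = -(x i * ∏ j ∈ s.erase i, (x i - 1 - x j)) := by
  simp only [shiftRemainder, eval_add, eval_sub, eval_mul, eval_X, eval_C,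
    Lagrange.eval_nodal_at_node hi]
  rw [Lagrange.eval_nodal, ← mul_prod_erase _ _ hi]
  simp only [sub_add_eq_sub_sub_swap]
  ring

end CommRing

theorem sum_mul_prod_erase_sub_one_div {K : Type*} [Field K] [DecidableEq ι] (s : Finset ι)
    {x : ι → K} (hx : Set.InjOn x s) :
    ∑ i ∈ s, x i * ∏ j ∈ s.erase i, ((x i - 1 - x j) / (x i - x j)) =
      ∑ i ∈ s, x i - ((#s).choose 2 : K) := by
  rcases s.eq_empty_or_nonempty with rfl | hs
  · simp
  have hcoeff := coeff_card_X_mul_shiftRemainder s x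
  rw [← Nat.sub_add_cancel hs.card_pos, coeff_X_mul, Nat.sub_add_cancel hs.card_pos,
    Lagrange.coeff_eq_sum hx (degree_shiftRemainder_lt s x)] at hcoeff
  rw [← neg_sub, ← hcoeff, ← sum_neg_distrib]
  refine sum_congr rfl fun i hi => ?_
  rw [eval_shiftRemainder hi, prod_div_distrib]
  ring

end Interpolation

section DifferenceProduct

variable {ι R : Type*} [LinearOrder ι] [CommRing R]

/-- The Vandermonde product of all differences `x a - x b` with `a < b` in `s`. -/
def differenceProduct (s : Finset ι) (x : ι → R) : R :=
  ∏ a ∈ s, ∏ b ∈ s with a < b, (x a - x b)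

theorem differenceProduct_congr {s : Finset ι} {x y : ι → R} (h : ∀ i ∈ s, x i = y i) :
    differenceProduct s x = differenceProduct s y :=
  prod_congr rfl fun a ha => prod_congr rfl fun b hb => by
    rw [h a ha, h b (mem_of_mem_filter b hb)]

theorem differenceProduct_eq_mul_erase {s : Finset ι} {i : ι} (hi : i ∈ s) (x : ι → R) :
    differenceProduct s x =
      (∏ j ∈ s.erase i, if j < i then -1 else 1) * differenceProduct (s.erase i) x *
        ∏ j ∈ s.erase i, (x i - x j) := by
  have hrow : ∏ b ∈ s with i < b, (x i - x b) =
      ∏ b ∈ s.erase i, if i < b then x i - x b else 1 := by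
    rw [prod_filter, ← mul_prod_erase _ _ hi, if_neg (lt_irrefl i), one_mul]
  have hcol : ∀ a, ∏ b ∈ s with a < b, (x a - x b) =
      (if a < i then x a - x i else 1) * ∏ b ∈ s.erase i with a < b, (x a - x b) := fun a => by
    rw [prod_filter, prod_filter, ← mul_prod_erase _ _ hi]
  have hsign : (∏ b ∈ s.erase i, if i < b then x i - x b else 1) *
      (∏ a ∈ s.erase i, if a < i then x a - x i else 1) =
        (∏ j ∈ s.erase i, if j < i then -1 else 1) * ∏ j ∈ s.erase i, (x i - x j) := by
    rw [← prod_mul_distrib, ← prod_mul_distrib]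
    refine prod_congr rfl fun j hj => ?_
    rcases lt_or_gt_of_ne (ne_of_mem_erase hj) with h | h
    · rw [if_neg h.not_gt, if_pos h, if_pos h]
      ring
    · rw [if_pos h, if_neg h.not_gt, if_neg h.not_gt]
      ring
  simp only [differenceProduct]
  rw [← mul_prod_erase _ _ hi, hrow]
  simp only [hcol]
  rw [prod_mul_distrib, ← mul_assoc, hsign, mul_right_comm]

theorem differenceProduct_update_mul {s : Finset ι} {i : ι} (hi : i ∈ s) (x : ι → R) (t : R) :
    differenceProduct s (Function.update x i t) * ∏ j ∈ s.erase i, (x i - x j) =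
      differenceProduct s x * ∏ j ∈ s.erase i, (t - x j) := by
  have hne : ∀ j ∈ s.erase i, Function.update x i t j = x j := fun j hj =>
    Function.update_of_ne (ne_of_mem_erase hj) t x
  have hprod : ∏ j ∈ s.erase i, (t - Function.update x i t j) = ∏ j ∈ s.erase i, (t - x j) :=
    prod_congr rfl fun j hj => by rw [hne j hj]
  rw [differenceProduct_eq_mul_erase hi, differenceProduct_eq_mul_erase hi,
    differenceProduct_congr hne, Function.update_self, hprod]
  ring

theorem differenceProduct_ne_zero [IsDomain R] {s : Finset ι} {x : ι → R} (hx : Set.InjOn x s) :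
    differenceProduct s x ≠ 0 :=
  prod_ne_zero_iff.2 fun _ ha => prod_ne_zero_iff.2 fun _ hb => sub_ne_zero.2 fun h =>
    (mem_filter.1 hb).2.ne (hx ha (mem_filter.1 hb).1 h)

end DifferenceProduct

section HookLengths

/-- The hook length of the cell `c` in row `c.1` and column `c.2`: the number of cells of `μ` beyond
`c` in its row or in its column, plus one. At a cell outside `μ` the truncated subtractions give
values without combinatorial meaning. -/
def hookLength (μ : YoungDiagram) (c : ℕ × ℕ) : ℕ :=
  (μ.rowLen c.1 - c.2 - 1) + (μ.colLen c.2 - c.1 - 1) + 1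

/-- The product of all hook lengths, the denominator of the hook length formula. -/
def hookProd (μ : YoungDiagram) : ℕ :=
  ∏ c ∈ μ.cells, hookLength μ c

/-- The `i`-th beta number of `μ`, regarded as a partition with `k` parts `rowLen 0, rowLen 1, …`:
the hook length at the start of row `i` if `k` is the exact number of nonempty rows. -/
def beta (μ : YoungDiagram) (k i : ℕ) : ℕ :=
  μ.rowLen i + (k - 1 - i)

theorem hookLength_pos (μ : YoungDiagram) (c : ℕ × ℕ) : 0 < hookLength μ c :=
  Nat.succ_pos _

theorem hookProd_pos (μ : YoungDiagram) : 0 < hookProd μ :=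
  prod_pos fun c _ => hookLength_pos μ c

theorem lt_rowLen_iff_lt_colLen {μ : YoungDiagram} {i j : ℕ} :
    j < μ.rowLen i ↔ i < μ.colLen j :=
  mem_iff_lt_rowLen.symm.trans mem_iff_lt_colLen

theorem hookLength_lt_hookLength {μ : YoungDiagram} {c d : ℕ × ℕ} (hcd : c < d) (hd : d ∈ μ) :
    hookLength μ d < hookLength μ c := by
  have hrow := μ.rowLen_anti c.1 d.1 hcd.le.1
  have hcol := μ.colLen_anti c.2 d.2 hcd.le.2
  have hd₁ : d.2 < μ.rowLen d.1 := mem_iff_lt_rowLen.1 hd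
  have hd₂ : d.1 < μ.colLen d.2 := mem_iff_lt_colLen.1 hd
  unfold hookLength
  rcases Prod.lt_iff.1 hcd with ⟨h₁, h₂⟩ | ⟨h₁, h₂⟩ <;> omega

theorem beta_strictAntiOn (μ : YoungDiagram) (k : ℕ) : StrictAntiOn (beta μ k) (range k) := by
  intro a _ b hb hab
  have hb : b < k := mem_range.1 hb
  have := μ.rowLen_anti a b hab.le
  unfold beta
  omega

theorem fst_lt_of_mem {μ : YoungDiagram} {k : ℕ} (hk : μ.colLen 0 ≤ k) {c : ℕ × ℕ} (hc : c ∈ μ) :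
    c.1 < k :=
  (mem_iff_lt_colLen.1 (μ.up_left_mem le_rfl (Nat.zero_le c.2) hc)).trans_le hk

theorem rowLen_eq_zero_of_colLen_le {μ : YoungDiagram} {i : ℕ} (hi : μ.colLen 0 ≤ i) :
    μ.rowLen i = 0 :=
  Nat.eq_zero_of_not_pos fun h => hi.not_gt (lt_rowLen_iff_lt_colLen.1 h)

theorem prod_cells_eq_prod_range {M : Type*} [CommMonoid M] {μ : YoungDiagram} {k : ℕ}
    (hk : μ.colLen 0 ≤ k) (f : ℕ × ℕ → M) :
    ∏ c ∈ μ.cells, f c = ∏ i ∈ range k, ∏ j ∈ range (μ.rowLen i), f (i, j) := by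
  rw [← prod_fiberwise_of_maps_to (t := range k) (g := Prod.fst)
    fun c hc => mem_range.2 (fst_lt_of_mem hk hc)]
  refine prod_congr rfl fun i _ => ?_
  have hrow : {c ∈ μ.cells | c.1 = i} = {i} ×ˢ range (μ.rowLen i) := row_eq_prod
  rw [hrow, prod_product, prod_singleton]

theorem card_eq_sum_rowLen {μ : YoungDiagram} {k : ℕ} (hk : μ.colLen 0 ≤ k) :
    μ.card = ∑ i ∈ range k, μ.rowLen i := by
  rw [YoungDiagram.card, card_eq_sum_card_fiberwise (t := range k) (f := Prod.fst)
    fun c hc => mem_coe.2 (mem_range.2 (fst_lt_of_mem hk hc))]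
  exact sum_congr rfl fun i _ => μ.rowLen_eq_card.symm

theorem hookLength_row_injOn (μ : YoungDiagram) (i : ℕ) :
    Set.InjOn (fun j => hookLength μ (i, j)) (range (μ.rowLen i)) :=
  StrictAntiOn.injOn fun _ _ _ hb hab =>
    hookLength_lt_hookLength (Prod.mk_lt_mk_iff_right.2 hab)
      (mem_iff_lt_rowLen.2 (mem_range.1 (mem_coe.1 hb)))

theorem beta_sub_beta_injOn (μ : YoungDiagram) (k i : ℕ) :
    Set.InjOn (fun b => beta μ k i - beta μ k b) (Ioo i k) := by
  refine StrictMonoOn.injOn fun a ha b hb hab => ?_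
  rw [coe_Ioo, Set.mem_Ioo] at ha hb
  have hi : i < k := ha.1.trans ha.2
  have hia := beta_strictAntiOn μ k (mem_range.2 hi) (mem_range.2 ha.2) ha.1
  have hab := beta_strictAntiOn μ k (mem_range.2 ha.2) (mem_range.2 hb.2) hab
  omega

theorem disjoint_hookLength_row_beta_sub_beta (μ : YoungDiagram) (k i : ℕ) :
    Disjoint ((range (μ.rowLen i)).image fun j => hookLength μ (i, j))
      ((Ioo i k).image fun b => beta μ k i - beta μ k b) := by
  simp only [disjoint_left, mem_image, mem_range, mem_Ioo, not_exists, not_and]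
  rintro _ ⟨j, hj, rfl⟩ b ⟨hib, hbk⟩ h
  have hij := lt_rowLen_iff_lt_colLen.1 hj
  have hbj : j < μ.rowLen b ↔ b < μ.colLen j := lt_rowLen_iff_lt_colLen
  simp only [hookLength, beta] at h
  omega

theorem image_hookLength_row_union_image_beta_sub_beta {μ : YoungDiagram} {k i : ℕ}
    (hk : μ.colLen 0 ≤ k) (hi : i < k) :
    ((range (μ.rowLen i)).image fun j => hookLength μ (i, j)) ∪
      ((Ioo i k).image fun b => beta μ k i - beta μ k b) = Icc 1 (beta μ k i) := by
  refine eq_of_subset_of_card_le (union_subset (image_subset_iff.2 fun j hj => ?_)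
    (image_subset_iff.2 fun b hb => ?_)) ?_
  · rw [mem_range] at hj
    have hcol := μ.colLen_anti 0 j (Nat.zero_le j)
    simp only [mem_Icc, hookLength, beta]
    omega
  · rw [mem_Ioo] at hb
    have := beta_strictAntiOn μ k (mem_range.2 hi) (mem_range.2 hb.2) hb.1
    rw [mem_Icc]
    omega
  · rw [card_union_of_disjoint (disjoint_hookLength_row_beta_sub_beta μ k i),
      card_image_of_injOn (hookLength_row_injOn μ i),
      card_image_of_injOn (beta_sub_beta_injOn μ k i), card_range, Nat.card_Ioo, Nat.card_Icc, beta]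
    omega

theorem prod_hookLength_row_mul_prod_beta_sub_beta {μ : YoungDiagram} {k i : ℕ}
    (hk : μ.colLen 0 ≤ k) (hi : i < k) :
    (∏ j ∈ range (μ.rowLen i), hookLength μ (i, j)) * ∏ b ∈ Ioo i k, (beta μ k i - beta μ k b) =
      (beta μ k i).factorial := by
  rw [← prod_image (f := fun m => m) (hookLength_row_injOn μ i),
    ← prod_image (f := fun m => m) (beta_sub_beta_injOn μ k i),
    ← prod_union (disjoint_hookLength_row_beta_sub_beta μ k i),
    image_hookLength_row_union_image_beta_sub_beta hk hi, ← prod_range_add_one_eq_factorial,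
    range_eq_Ico, prod_Ico_add' (fun m => m), zero_add, Ico_add_one_right_eq_Icc]

theorem hookProd_mul_differenceProduct_beta {R : Type*} [CommRing R] {μ : YoungDiagram} {k : ℕ}
    (hk : μ.colLen 0 ≤ k) :
    (hookProd μ : R) * differenceProduct (range k) (fun i => (beta μ k i : R)) =
      ∏ i ∈ range k, ((beta μ k i).factorial : R) := by
  rw [hookProd, prod_cells_eq_prod_range hk, Nat.cast_prod, differenceProduct, ← prod_mul_distrib]
  refine prod_congr rfl fun a ha => ?_
  have hIoo : {b ∈ range k | a < b} = Ioo a k := by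
    ext b
    simp only [mem_filter, mem_range, mem_Ioo, and_comm]
  rw [← prod_hookLength_row_mul_prod_beta_sub_beta hk (mem_range.1 ha), Nat.cast_mul, hIoo,
    Nat.cast_prod (fun b => beta μ k a - beta μ k b)]
  congr 1
  refine prod_congr rfl fun b hb => ?_
  rw [mem_Ioo] at hb
  rw [Nat.cast_sub (beta_strictAntiOn μ k ha (mem_range.2 hb.2) hb.1).le]

end HookLengths

section LinearExtensions

variable {α : Type*}

/-- A linear extension of the order on the finite set `s`: a strictly monotone numbering of its
elements by `1, …, #s`. It is encoded as a function on the whole type that vanishes outside `s`, so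
that linear extensions of different sets can be compared. -/
structure IsLinearExtension [Preorder α] (s : Finset α) (f : α → ℕ) : Prop where
  eq_zero_of_notMem : ∀ a, a ∉ s → f a = 0
  bijOn : Set.BijOn f s (Set.Icc 1 #s)
  strictMonoOn : StrictMonoOn f s

/-- The number of linear extensions of the order on `s`. -/
noncomputable def numLinearExtensions [Preorder α] (s : Finset α) : ℕ :=
  Nat.card {f : α → ℕ // IsLinearExtension s f}

open Classical in
/-- The maximal elements of the finite set `s`, where the largest number of a linear extension can
stand. -/
noncomputable def maximalElements [Preorder α] (s : Finset α) : Finset α :=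
  {m ∈ s | Maximal (· ∈ s) m}

variable [Preorder α] {s : Finset α} {f : α → ℕ} {m : α}

theorem mem_maximalElements : m ∈ maximalElements s ↔ Maximal (· ∈ s) m := by
  simp only [maximalElements, mem_filter, and_iff_right_iff_imp]
  exact Maximal.prop

namespace IsLinearExtension

theorem le_card (hf : IsLinearExtension s f) (a : α) : f a ≤ #s := by
  by_cases ha : a ∈ s
  · exact (hf.bijOn.mapsTo ha).2
  · simp only [hf.eq_zero_of_notMem a ha, Nat.zero_le]

theorem maximal_of_apply_eq_card (hf : IsLinearExtension s f) (hm : m ∈ s) (hfm : f m = #s) :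
    Maximal (· ∈ s) m :=
  ⟨hm, fun b hb hmb => by_contra fun hbm =>
    (hf.strictMonoOn hm hb (lt_of_le_not_ge hmb hbm)).not_ge (hfm ▸ hf.le_card b)⟩

variable [DecidableEq α]

theorem lt_card_of_erase (hm : m ∈ s) (hf : IsLinearExtension (s.erase m) f) (a : α) :
    f a < #s :=
  (hf.le_card a).trans_lt (card_erase_lt_of_mem hm)

theorem update_card (hm : Maximal (· ∈ s) m) (hf : IsLinearExtension (s.erase m) f) :
    IsLinearExtension s (Function.update f m #s) := by
  have hcard : #(s.erase m) + 1 = #s := card_erase_add_one hm.prop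
  have heq : Set.EqOn f (Function.update f m #s) (s.erase m) := fun a ha =>
    (Function.update_of_ne (ne_of_mem_erase ha) _ _).symm
  refine ⟨fun a ha => ?_, ?_, fun a ha b hb hab => ?_⟩
  · rw [Function.update_of_ne (ne_of_mem_of_not_mem hm.prop ha).symm]
    exact hf.eq_zero_of_notMem a fun h => ha (mem_of_mem_erase h)
  · have hnot : Function.update f m #s m ∉ Set.Icc 1 #(s.erase m) := fun h => by
      have := h.2
      rw [Function.update_self] at this
      omega
    have hbij := (hf.bijOn.congr heq).insert hnot
    rwa [← coe_insert, insert_erase hm.prop, Function.update_self, ← hcard,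
      Set.insert_Icc_right_eq_Icc_add_one (by omega), hcard] at hbij
  · have ham : a ≠ m := by
      rintro rfl
      exact hab.not_ge (hm.2 hb hab.le)
    rw [Function.update_of_ne ham]
    rcases eq_or_ne b m with rfl | hbm
    · rw [Function.update_self]
      exact hf.lt_card_of_erase hm.prop a
    · rw [Function.update_of_ne hbm]
      exact hf.strictMonoOn (mem_erase.2 ⟨ham, ha⟩) (mem_erase.2 ⟨hbm, hb⟩) hab

theorem update_zero (hf : IsLinearExtension s f) (hm : m ∈ s) (hfm : f m = #s) :
    IsLinearExtension (s.erase m) (Function.update f m 0) := by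
  have hcard : #(s.erase m) + 1 = #s := card_erase_add_one hm
  have heq : Set.EqOn f (Function.update f m 0) (s.erase m) := fun a ha =>
    (Function.update_of_ne (ne_of_mem_erase ha) _ _).symm
  refine ⟨fun a ha => ?_, ?_, ?_⟩
  · rcases eq_or_ne a m with rfl | ham
    · exact Function.update_self ..
    · rw [Function.update_of_ne ham]
      exact hf.eq_zero_of_notMem a fun h => ha (mem_erase.2 ⟨ham, h⟩)
  · have hbij := hf.bijOn.sdiff_singleton (mem_coe.2 hm)
    have hIcc : Set.Icc 1 #s \ {f m} = Set.Icc 1 #(s.erase m) := by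
      ext n
      simp only [Set.mem_sdiff, Set.mem_Icc, Set.mem_singleton_iff]
      omega
    rw [← coe_erase, hIcc] at hbij
    exact hbij.congr heq
  · exact (hf.strictMonoOn.mono (coe_subset.2 (erase_subset m s))).congr heq

end IsLinearExtension

instance finite_linearExtensions (s : Finset α) :
    Finite {f : α → ℕ // IsLinearExtension s f} := by
  refine Finite.of_injective
    (fun f (a : s) => (⟨f.1 a, Nat.lt_succ_of_le (f.2.le_card a)⟩ : Fin (#s + 1))) fun f g hfg => ?_
  refine Subtype.ext (funext fun a => ?_)
  by_cases ha : a ∈ s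
  · exact congrArg Fin.val (congrFun hfg ⟨a, ha⟩)
  · rw [f.2.eq_zero_of_notMem a ha, g.2.eq_zero_of_notMem a ha]

theorem numLinearExtensions_empty : numLinearExtensions (∅ : Finset α) = 1 := by
  have hzero : IsLinearExtension (∅ : Finset α) 0 :=
    ⟨fun _ _ => rfl, by simp, by simp [StrictMonoOn]⟩
  rw [numLinearExtensions, Nat.card_eq_one_iff_exists]
  exact ⟨⟨0, hzero⟩, fun f => Subtype.ext (funext fun a =>
    f.2.eq_zero_of_notMem a (notMem_empty a))⟩

theorem numLinearExtensions_eq_sum [DecidableEq α] (hs : s.Nonempty) :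
    numLinearExtensions s = ∑ m ∈ maximalElements s, numLinearExtensions (s.erase m) := by
  have hmax : ∀ m : maximalElements s, Maximal (· ∈ s) m.1 := fun m => mem_maximalElements.1 m.2
  simp only [numLinearExtensions]
  rw [← sum_coe_sort (maximalElements s), ← Nat.card_sigma]
  refine (Nat.card_congr (Equiv.ofBijective (fun p =>
    ⟨Function.update p.2.1 p.1.1 #s, p.2.2.update_card (hmax p.1)⟩) ⟨?_, ?_⟩)).symm
  · rintro ⟨m, f, hf⟩ ⟨m', f', hf'⟩ h
    have h : Function.update f m.1 #s = Function.update f' m'.1 #s := congrArg Subtype.val h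
    obtain rfl : m = m' := by
      refine Subtype.ext (by_contra fun hne => ?_)
      have hm := congrFun h m.1
      rw [Function.update_self, Function.update_of_ne hne] at hm
      exact (hf'.lt_card_of_erase (hmax m').prop m.1).ne' hm
    obtain rfl : f = f' := by
      funext a
      rcases eq_or_ne a m.1 with rfl | ha
      · rw [hf.eq_zero_of_notMem _ (notMem_erase _ _), hf'.eq_zero_of_notMem _ (notMem_erase _ _)]
      · simpa only [Function.update_of_ne ha] using congrFun h a
    rfl
  · rintro ⟨f, hf⟩
    obtain ⟨m, hm, hfm⟩ := hf.bijOn.surjOn ⟨hs.card_pos, le_rfl⟩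
    refine ⟨⟨⟨m, mem_maximalElements.2 (hf.maximal_of_apply_eq_card hm hfm)⟩,
      ⟨_, hf.update_zero hm hfm⟩⟩, Subtype.ext ?_⟩
    simp only [Function.update_idem, ← hfm, Function.update_eq_self]

/-- The numbering of the elements of `s` given by a linear extension. -/
noncomputable def IsLinearExtension.equiv (hf : IsLinearExtension s f) : s ≃ Icc 1 #s :=
  Equiv.ofBijective (fun a => ⟨f a, mem_Icc.2 (hf.bijOn.mapsTo a.2)⟩)
    ⟨fun a b hab => Subtype.ext (hf.bijOn.injOn a.2 b.2 (congrArg Subtype.val hab)), fun n => by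
      obtain ⟨a, ha, han⟩ := hf.bijOn.surjOn (mem_Icc.1 n.2)
      exact ⟨⟨a, ha⟩, Subtype.ext han⟩⟩

theorem isLinearExtension_of_strictMono_equiv {e : s ≃ Icc 1 #s} (he : StrictMono e)
    (hf : ∀ a : s, f a = e a) (hf₀ : ∀ a, a ∉ s → f a = 0) : IsLinearExtension s f := by
  refine ⟨hf₀, ⟨fun a ha => ?_, fun a ha b hb hab => ?_, fun n hn => ?_⟩, fun a ha b hb hab => ?_⟩
  · exact hf ⟨a, ha⟩ ▸ mem_Icc.1 (e ⟨a, ha⟩).2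
  · rw [hf ⟨a, ha⟩, hf ⟨b, hb⟩, Subtype.val_inj, e.injective.eq_iff] at hab
    exact congrArg Subtype.val hab
  · obtain ⟨a, ha⟩ := e.surjective ⟨n, mem_Icc.2 hn⟩
    exact ⟨a, a.2, by rw [hf, ha]⟩
  · rw [hf ⟨a, ha⟩, hf ⟨b, hb⟩]
    exact he hab

theorem numLinearExtensions_eq_card_strictMono_equiv (s : Finset α) :
    numLinearExtensions s = Nat.card {e : s ≃ Icc 1 #s // StrictMono e} := by
  classical
  refine Nat.card_congr (Equiv.ofBijective
    (fun f => ⟨f.2.equiv, fun a b hab => f.2.strictMonoOn a.2 b.2 hab⟩)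
    ⟨fun f g hfg => Subtype.ext (funext fun a => ?_), ?_⟩)
  · by_cases ha : a ∈ s
    · exact congrArg (fun e => (e.1 ⟨a, ha⟩ : ℕ)) hfg
    · rw [f.2.eq_zero_of_notMem a ha, g.2.eq_zero_of_notMem a ha]
  · rintro ⟨e, he⟩
    let f : α → ℕ := fun a => if h : a ∈ s then e ⟨a, h⟩ else 0
    have hfe : ∀ a : s, f a = e a := fun a => dif_pos a.2
    exact ⟨⟨f, isLinearExtension_of_strictMono_equiv he hfe fun a ha => dif_neg ha⟩,
      Subtype.ext (Equiv.ext fun a => Subtype.ext (hfe a))⟩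

end LinearExtensions

section StandardTableaux

theorem strictMono_entry {μ : YoungDiagram} (T : μ.StandardTableau) : StrictMono T.entry := by
  rintro ⟨c, hc⟩ ⟨d, hd⟩ hcd
  have hcd : c < d := hcd
  have he : (c.1, d.2) ∈ μ.cells := μ.up_left_mem hcd.le.1 le_rfl hd
  have hrow : T.entry ⟨c, hc⟩ ≤ T.entry ⟨(c.1, d.2), he⟩ := by
    rcases hcd.le.2.eq_or_lt with h | h
    · exact (congrArg T.entry (Subtype.ext (Prod.ext rfl h : c = (c.1, d.2)))).le
    · exact (T.row_lt ⟨c, hc⟩ ⟨_, he⟩ rfl h).le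
  have hcol : T.entry ⟨(c.1, d.2), he⟩ ≤ T.entry ⟨d, hd⟩ := by
    rcases hcd.le.1.eq_or_lt with h | h
    · exact (congrArg T.entry (Subtype.ext (Prod.ext h rfl : (c.1, d.2) = d))).le
    · exact (T.col_lt ⟨_, he⟩ ⟨d, hd⟩ rfl h).le
  exact (hrow.trans hcol).lt_of_ne fun h => hcd.ne (congrArg Subtype.val (T.entry.injective h))

theorem dim_eq_numLinearExtensions (μ : YoungDiagram) : μ.dim = numLinearExtensions μ.cells := by
  rw [numLinearExtensions_eq_card_strictMono_equiv]
  refine Nat.card_congr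
    { toFun := fun T => ⟨T.entry, strictMono_entry T⟩
      invFun := fun e => ⟨e.1, fun c d h₁ h₂ => e.2 ?_, fun c d h₁ h₂ => e.2 ?_⟩
      left_inv := fun _ => rfl
      right_inv := fun _ => rfl }
  · exact Prod.lt_iff.2 (Or.inr ⟨h₁.le, h₂⟩)
  · exact Prod.lt_iff.2 (Or.inl ⟨h₂, h₁.le⟩)

end StandardTableaux

section Corners

variable {μ ν : YoungDiagram} {c : ℕ × ℕ}

/-- The diagram of the cells of `μ` that are not weakly beyond `c`. If `c` is a corner, that is, a
maximal cell of `μ`, then only `c` is removed. -/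
def removeBeyond (μ : YoungDiagram) (c : ℕ × ℕ) : YoungDiagram where
  cells := {d ∈ μ.cells | ¬c ≤ d}
  isLowerSet a b hba ha := by
    rw [mem_coe, mem_filter] at ha ⊢
    exact ⟨μ.isLowerSet hba ha.1, fun h => ha.2 (h.trans hba)⟩

theorem cells_removeBeyond (hc : Maximal (· ∈ μ.cells) c) :
    (removeBeyond μ c).cells = μ.cells.erase c := by
  ext d
  rw [removeBeyond, mem_filter, mem_erase, and_comm]
  exact and_congr_left fun hd => not_congr ⟨fun h => (hc.2 hd h).antisymm h, fun h => h.ge⟩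

theorem card_removeBeyond (hc : Maximal (· ∈ μ.cells) c) :
    (removeBeyond μ c).card + 1 = μ.card := by
  rw [YoungDiagram.card, cells_removeBeyond hc, card_erase_add_one hc.prop]

theorem maximal_mem_cells_iff :
    Maximal (· ∈ μ.cells) c ↔ μ.rowLen c.1 = c.2 + 1 ∧ μ.rowLen (c.1 + 1) ≤ c.2 := by
  obtain ⟨i, j⟩ := c
  refine ⟨fun h => ?_, fun ⟨h₁, h₂⟩ => ⟨mem_iff_lt_rowLen.2 (by dsimp only at h₁; omega), ?_⟩⟩
  · have hmem : j < μ.rowLen i := mem_iff_lt_rowLen.1 h.prop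
    have hright : ¬j + 1 < μ.rowLen i := fun hj => by
      have := (h.2 (mem_iff_lt_rowLen.2 hj) ⟨le_rfl, Nat.le_succ j⟩).2
      dsimp only at this
      omega
    have habove : ¬j < μ.rowLen (i + 1) := fun hj => by
      have := (h.2 (mem_iff_lt_rowLen.2 hj) ⟨Nat.le_succ i, le_rfl⟩).1
      dsimp only at this
      omega
    dsimp only
    omega
  · rintro ⟨a, b⟩ hab ⟨hia, hjb⟩
    dsimp only at h₁ h₂ hia hjb
    have hb : b < μ.rowLen a := mem_iff_lt_rowLen.1 hab
    rcases hia.eq_or_lt with rfl | hlt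
    · exact ⟨le_rfl, by dsimp only; omega⟩
    · have := μ.rowLen_anti (i + 1) a hlt
      omega

theorem colLen_le_colLen (h : ν ≤ μ) (j : ℕ) : ν.colLen j ≤ μ.colLen j :=
  le_of_forall_lt fun _ hi => mem_iff_lt_colLen.1 (h (mem_iff_lt_colLen.2 hi))

theorem rowLen_of_cells_eq_erase (hc : c ∈ μ) (hν : ν.cells = μ.cells.erase c) :
    μ.rowLen c.1 = c.2 + 1 ∧ ν.rowLen = Function.update μ.rowLen c.1 c.2 := by
  obtain ⟨i, j⟩ := c
  have hlt : ∀ a b, b < ν.rowLen a ↔ (a, b) ≠ (i, j) ∧ b < μ.rowLen a := fun a b => by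
    rw [← mem_iff_lt_rowLen, ← mem_cells, hν, mem_erase, mem_cells, mem_iff_lt_rowLen]
  have hνi : ν.rowLen i ≤ j := not_lt.1 fun h => ((hlt i j).1 h).1 rfl
  have hμi : μ.rowLen i = j + 1 := by
    have hj : j < μ.rowLen i := mem_iff_lt_rowLen.1 hc
    have := hlt i (j + 1)
    rw [Ne, Prod.mk.injEq] at this
    omega
  refine ⟨hμi, funext fun a => eq_of_forall_lt_iff fun b => ?_⟩
  rw [hlt, Ne, Prod.mk.injEq]
  rcases eq_or_ne a i with rfl | ha
  · rw [Function.update_self]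
    omega
  · rw [Function.update_of_ne ha, and_iff_right fun h => ha h.1]

theorem beta_of_cells_eq_erase (hc : c ∈ μ) (hν : ν.cells = μ.cells.erase c) (k : ℕ) :
    0 < beta μ k c.1 ∧ beta ν k = Function.update (beta μ k) c.1 (beta μ k c.1 - 1) := by
  obtain ⟨hrow, hupdate⟩ := rowLen_of_cells_eq_erase hc hν
  refine ⟨by rw [beta]; omega, funext fun a => ?_⟩
  rw [beta, hupdate]
  rcases eq_or_ne a c.1 with rfl | ha
  · rw [Function.update_self, Function.update_self, beta]
    omega
  · rw [Function.update_of_ne ha, Function.update_of_ne ha, beta]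

theorem prod_factorial_beta_of_cells_eq_erase (hc : c ∈ μ) (hν : ν.cells = μ.cells.erase c)
    {k : ℕ} (hk : c.1 < k) :
    ∏ i ∈ range k, (beta μ k i).factorial =
      beta μ k c.1 * ∏ i ∈ range k, (beta ν k i).factorial := by
  obtain ⟨hpos, hupdate⟩ := beta_of_cells_eq_erase hc hν k
  rw [← mul_prod_erase _ _ (mem_range.2 hk), ← mul_prod_erase _ _ (mem_range.2 hk), ← mul_assoc,
    hupdate, Function.update_self, Nat.mul_factorial_pred hpos.ne']
  congr 1
  exact prod_congr rfl fun i hi => by rw [Function.update_of_ne (ne_of_mem_erase hi)]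

theorem beta_cast_injOn (μ : YoungDiagram) (k : ℕ) :
    Set.InjOn (fun i => (beta μ k i : ℚ)) (range k) :=
  Nat.cast_injective.comp_injOn (beta_strictAntiOn μ k).injOn

theorem hookProd_mul_prod_beta_sub_of_cells_eq_erase (hc : c ∈ μ)
    (hν : ν.cells = μ.cells.erase c) {k : ℕ} (hk : μ.colLen 0 ≤ k) :
    (hookProd μ : ℚ) * ∏ j ∈ (range k).erase c.1, ((beta μ k c.1 : ℚ) - beta μ k j) =
      beta μ k c.1 * (∏ j ∈ (range k).erase c.1, ((beta μ k c.1 : ℚ) - 1 - beta μ k j)) *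
        hookProd ν := by
  obtain ⟨hpos, hupdate⟩ := beta_of_cells_eq_erase hc hν k
  have hck : c.1 ∈ range k := mem_range.2 (fst_lt_of_mem hk hc)
  have hνk : ν.colLen 0 ≤ k :=
    (colLen_le_colLen (cells_subset_iff.1 (hν.trans_subset (erase_subset _ _))) 0).trans hk
  let x : ℕ → ℚ := fun i => beta μ k i
  have hx : (fun i => (beta ν k i : ℚ)) = Function.update x c.1 (x c.1 - 1) := by
    funext i
    rw [hupdate, Function.apply_update (fun _ (n : ℕ) => (n : ℚ)), Nat.cast_pred hpos]
  have hμprod := hookProd_mul_differenceProduct_beta (R := ℚ) hk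
  have hνprod := hookProd_mul_differenceProduct_beta (R := ℚ) hνk
  have hfact : (∏ i ∈ range k, (beta μ k i).factorial : ℚ) =
      beta μ k c.1 * ∏ i ∈ range k, ((beta ν k i).factorial : ℚ) := by
    exact_mod_cast prod_factorial_beta_of_cells_eq_erase hc hν (mem_range.1 hck)
  have hdiff := differenceProduct_update_mul hck x (x c.1 - 1)
  apply mul_right_cancel₀ (differenceProduct_ne_zero (beta_cast_injOn μ k))
  rw [hx] at hνprod
  rw [hfact, ← hνprod] at hμprod
  linear_combination
    (∏ j ∈ (range k).erase c.1, (x c.1 - x j)) * hμprod + x c.1 * hookProd ν * hdiff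

theorem hookProd_div_hookProd_of_cells_eq_erase (hc : c ∈ μ) (hν : ν.cells = μ.cells.erase c)
    {k : ℕ} (hk : μ.colLen 0 ≤ k) :
    (hookProd μ : ℚ) / hookProd ν = beta μ k c.1 * ∏ j ∈ (range k).erase c.1,
      (((beta μ k c.1 : ℚ) - 1 - beta μ k j) / ((beta μ k c.1 : ℚ) - beta μ k j)) := by
  have hpos : (hookProd ν : ℚ) ≠ 0 := mod_cast (hookProd_pos ν).ne'
  have hne : ∏ j ∈ (range k).erase c.1, ((beta μ k c.1 : ℚ) - beta μ k j) ≠ 0 :=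
    prod_ne_zero_iff.2 fun j hj => sub_ne_zero.2 fun h => ne_of_mem_erase hj
      (beta_cast_injOn μ k (mem_range.2 (fst_lt_of_mem hk hc)) (mem_of_mem_erase hj) h).symm
  rw [prod_div_distrib, mul_div_assoc', div_eq_div_iff hpos hne,
    hookProd_mul_prod_beta_sub_of_cells_eq_erase hc hν hk]

theorem sum_beta {k : ℕ} (hk : μ.colLen 0 ≤ k) :
    ∑ i ∈ range k, beta μ k i = μ.card + k.choose 2 := by
  simp only [beta]
  rw [sum_add_distrib, card_eq_sum_rowLen hk, sum_range_reflect (fun i => i) k, sum_range_id,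
    Nat.choose_two_right]

theorem beta_mul_prod_eq_zero_of_not_corner {i k : ℕ} (hk : μ.colLen 0 ≤ k) (hi : i < k)
    (hcorner : ∀ c, Maximal (· ∈ μ.cells) c → c.1 ≠ i) :
    (beta μ k i : ℚ) * ∏ j ∈ (range k).erase i,
      (((beta μ k i : ℚ) - 1 - beta μ k j) / ((beta μ k i : ℚ) - beta μ k j)) = 0 := by
  have hrow : μ.rowLen i = μ.rowLen (i + 1) := by
    have hanti := μ.rowLen_anti i (i + 1) (Nat.le_succ i)
    by_contra hne
    refine hcorner (i, μ.rowLen i - 1) (maximal_mem_cells_iff.2 ?_) rfl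
    dsimp only
    omega
  rcases (Nat.succ_le_of_lt hi).eq_or_lt with rfl | hi'
  · have hbeta : beta μ (i + 1) i = 0 := by
      rw [beta, hrow, rowLen_eq_zero_of_colLen_le hk]
      omega
    rw [hbeta, Nat.cast_zero, zero_mul]
  · have hbeta : beta μ k i = beta μ k (i + 1) + 1 := by
      rw [beta, beta, hrow]
      omega
    refine mul_eq_zero_of_right _ (prod_eq_zero (i := i + 1) ?_ ?_)
    · exact mem_erase.2 ⟨Nat.succ_ne_self i, mem_range.2 hi'⟩
    · rw [hbeta, Nat.cast_add_one, add_sub_cancel_right, sub_self, zero_div]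

theorem sum_hookProd_div (μ : YoungDiagram) :
    ∑ c ∈ maximalElements μ.cells, (hookProd μ : ℚ) / hookProd (removeBeyond μ c) = μ.card := by
  obtain ⟨k, hk⟩ : ∃ k, μ.colLen 0 ≤ k := ⟨_, le_rfl⟩
  have hinterp := sum_mul_prod_erase_sub_one_div (range k) (beta_cast_injOn μ k)
  rw [← Nat.cast_sum, sum_beta hk, card_range, Nat.cast_add, add_sub_cancel_right] at hinterp
  rw [← hinterp]
  refine sum_of_injOn Prod.fst ?_ ?_ ?_ ?_
  · intro c hc d hd hcd
    have hc := maximal_mem_cells_iff.1 (mem_maximalElements.1 hc)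
    have hd := maximal_mem_cells_iff.1 (mem_maximalElements.1 hd)
    refine Prod.ext hcd (Nat.succ_injective ?_)
    rw [Nat.succ_eq_add_one, Nat.succ_eq_add_one, ← hc.1, ← hd.1, hcd]
  · exact fun c hc => mem_range.2 (fst_lt_of_mem hk (mem_maximalElements.1 hc).prop)
  · intro i hi himage
    exact beta_mul_prod_eq_zero_of_not_corner hk (mem_range.1 hi) fun c hc h =>
      himage ⟨c, mem_maximalElements.2 hc, h⟩
  · intro c hc
    have hc := mem_maximalElements.1 hc
    exact hookProd_div_hookProd_of_cells_eq_erase hc.prop (cells_removeBeyond hc) hk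

end Corners

section HookLengthFormula

theorem dim_mul_hookProd (μ : YoungDiagram) : μ.dim * hookProd μ = μ.card.factorial := by
  induction hn : μ.card generalizing μ with
  | zero =>
    have hcells : μ.cells = ∅ := card_eq_zero.1 hn
    rw [dim_eq_numLinearExtensions, hookProd, hcells, numLinearExtensions_empty, prod_empty,
      Nat.factorial_zero, one_mul]
  | succ n ih =>
    have hnonempty : μ.cells.Nonempty := card_pos.1 (n.succ_pos.trans_eq hn.symm)
    have hdim : ∀ c ∈ maximalElements μ.cells, (numLinearExtensions (μ.cells.erase c) : ℚ) =
        n.factorial / hookProd (removeBeyond μ c) := fun c hc => by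
      have hc := mem_maximalElements.1 hc
      have hpos : (hookProd (removeBeyond μ c) : ℚ) ≠ 0 := mod_cast (hookProd_pos _).ne'
      rw [← cells_removeBeyond hc, ← dim_eq_numLinearExtensions, eq_div_iff hpos]
      exact_mod_cast ih _ (by have := card_removeBeyond hc; omega)
    have hsum := sum_hookProd_div μ
    qify
    rw [dim_eq_numLinearExtensions, numLinearExtensions_eq_sum hnonempty, Nat.cast_sum,
      sum_congr rfl hdim, sum_mul, Nat.factorial_succ, Nat.cast_mul, ← hn, ← hsum, sum_mul]
    exact sum_congr rfl fun c _ => by ring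

theorem dim_le_dim_of_hookProd_le {μ ν : YoungDiagram} (hcard : ν.card = μ.card)
    (h : hookProd ν ≤ hookProd μ) : μ.dim ≤ ν.dim := by
  refine Nat.le_of_mul_le_mul_right ?_ (hookProd_pos μ)
  rw [dim_mul_hookProd μ, ← hcard, ← dim_mul_hookProd ν]
  exact Nat.mul_le_mul_left _ h

theorem dim_lt_dim_of_hookProd_lt {μ ν : YoungDiagram} (hcard : ν.card = μ.card)
    (h : hookProd ν < hookProd μ) : μ.dim < ν.dim := by
  have hdim : 0 < ν.dim :=
    Nat.pos_of_mul_pos_right (dim_mul_hookProd ν ▸ Nat.factorial_pos _)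
  refine Nat.lt_of_mul_lt_mul_right (a := hookProd μ) ?_
  rw [dim_mul_hookProd μ, ← hcard, ← dim_mul_hookProd ν]
  exact Nat.mul_lt_mul_of_pos_left h hdim

end HookLengthFormula

section Extensions

/-- The number of boxes of `B` in row `i`. -/
def rowCount (B : Finset (ℕ × ℕ)) (i : ℕ) : ℕ :=
  #{b ∈ B | b.1 = i}

/-- The number of boxes of `B` in column `j`. -/
def colCount (B : Finset (ℕ × ℕ)) (j : ℕ) : ℕ :=
  #{b ∈ B | b.2 = j}

theorem rowCount_union {A B : Finset (ℕ × ℕ)} (h : Disjoint A B) (i : ℕ) :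
    rowCount (A ∪ B) i = rowCount A i + rowCount B i := by
  rw [rowCount, filter_union, card_union_of_disjoint (disjoint_filter_filter h), rowCount, rowCount]

theorem colCount_union {A B : Finset (ℕ × ℕ)} (h : Disjoint A B) (j : ℕ) :
    colCount (A ∪ B) j = colCount A j + colCount B j := by
  rw [colCount, filter_union, card_union_of_disjoint (disjoint_filter_filter h), colCount, colCount]

theorem rowCount_image_swap (B : Finset (ℕ × ℕ)) (i : ℕ) :
    rowCount (B.image Prod.swap) i = colCount B i := by
  rw [rowCount, filter_image, card_image_of_injective _ Prod.swap_injective]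
  rfl

theorem colCount_image_swap (B : Finset (ℕ × ℕ)) (j : ℕ) :
    colCount (B.image Prod.swap) j = rowCount B j := by
  rw [colCount, filter_image, card_image_of_injective _ Prod.swap_injective]
  rfl

variable {σ ν : YoungDiagram} {B : Finset (ℕ × ℕ)}

theorem rowLen_of_cells_eq_union (hB : Disjoint σ.cells B) (hν : ν.cells = σ.cells ∪ B) (i : ℕ) :
    ν.rowLen i = σ.rowLen i + rowCount B i := by
  rw [rowLen_eq_card, rowLen_eq_card]
  exact (congrArg (rowCount · i) hν).trans (rowCount_union hB i)

theorem colLen_of_cells_eq_union (hB : Disjoint σ.cells B) (hν : ν.cells = σ.cells ∪ B) (j : ℕ) :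
    ν.colLen j = σ.colLen j + colCount B j := by
  rw [colLen_eq_card, colLen_eq_card]
  exact (congrArg (colCount · j) hν).trans (colCount_union hB j)

/-- The box `c` can be added to `σ`: it is the first box beyond `σ` both in its row and in its
column. -/
def IsAddable (σ : YoungDiagram) (c : ℕ × ℕ) : Prop :=
  c.2 = σ.rowLen c.1 ∧ c.1 = σ.colLen c.2

theorem IsAddable.notMem {c : ℕ × ℕ} (h : IsAddable σ c) : c ∉ σ := fun hc =>
  (mem_iff_lt_rowLen.1 hc).ne h.1

theorem isAddable_of_count_le_one (hB : Disjoint σ.cells B) (hν : ν.cells = σ.cells ∪ B)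
    (hrow : ∀ i, rowCount B i ≤ 1) (hcol : ∀ j, colCount B j ≤ 1) {c : ℕ × ℕ} (hc : c ∈ B) :
    IsAddable σ c := by
  have hcν : c ∈ ν.cells := hν ▸ mem_union_right _ hc
  have hcσ : c ∉ σ := disjoint_right.1 hB hc
  have hr := rowLen_of_cells_eq_union hB hν c.1
  have hl := colLen_of_cells_eq_union hB hν c.2
  have hcν₁ : c.2 < ν.rowLen c.1 := mem_iff_lt_rowLen.1 hcν
  have hcν₂ : c.1 < ν.colLen c.2 := mem_iff_lt_colLen.1 hcν
  have hcσ₁ : σ.rowLen c.1 ≤ c.2 := not_lt.1 (mt mem_iff_lt_rowLen.2 hcσ)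
  have hcσ₂ : σ.colLen c.2 ≤ c.1 := not_lt.1 (mt mem_iff_lt_colLen.2 hcσ)
  have := hrow c.1
  have := hcol c.2
  exact ⟨by omega, by omega⟩

variable (hB : ∀ b ∈ B, IsAddable σ b)

include hB

theorem exists_cells_eq_union : ∃ ν : YoungDiagram, ν.cells = σ.cells ∪ B := by
  refine ⟨⟨σ.cells ∪ B, fun c d hdc hc => ?_⟩, rfl⟩
  simp only [coe_union, Set.mem_union, mem_coe] at hc ⊢
  rcases hc with hc | hc
  · exact Or.inl (σ.isLowerSet hdc hc)
  obtain ⟨hrow, hcol⟩ := hB c hc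
  rcases hdc.1.lt_or_eq with h₁ | h₁
  · exact Or.inl (σ.up_left_mem le_rfl hdc.2 (mem_iff_lt_colLen.2 (hcol ▸ h₁)))
  rcases hdc.2.lt_or_eq with h₂ | h₂
  · exact Or.inl (σ.up_left_mem hdc.1 le_rfl (mem_iff_lt_rowLen.2 (hrow ▸ h₂)))
  · exact Or.inr (Prod.ext h₁ h₂ ▸ hc)

theorem disjoint_cells_of_isAddable : Disjoint σ.cells B :=
  disjoint_right.2 fun b hb => (hB b hb).notMem

theorem rowCount_le_one_of_isAddable (i : ℕ) : rowCount B i ≤ 1 := by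
  simp only [rowCount, card_le_one, mem_filter]
  rintro a ⟨ha, rfl⟩ b ⟨hb, hba⟩
  exact Prod.ext hba.symm (by rw [(hB a ha).1, (hB b hb).1, hba])

theorem colCount_le_one_of_isAddable (j : ℕ) : colCount B j ≤ 1 := by
  simp only [colCount, card_le_one, mem_filter]
  rintro a ⟨ha, rfl⟩ b ⟨hb, hba⟩
  exact Prod.ext (by rw [(hB a ha).2, (hB b hb).2, hba]) hba.symm

theorem hookProd_of_cells_eq_union (hν : ν.cells = σ.cells ∪ B) :
    hookProd ν = ∏ c ∈ σ.cells, (hookLength σ c + rowCount B c.1 + colCount B c.2) := by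
  have hdisj := disjoint_cells_of_isAddable hB
  have hrow := rowLen_of_cells_eq_union hdisj hν
  have hcol := colLen_of_cells_eq_union hdisj hν
  have hnew : ∏ c ∈ B, hookLength ν c = 1 := prod_eq_one fun c hc => by
    obtain ⟨h₁, h₂⟩ := hB c hc
    have := rowCount_le_one_of_isAddable hB c.1
    have := colCount_le_one_of_isAddable hB c.2
    rw [hookLength, hrow, hcol]
    omega
  rw [hookProd, hν, prod_union hdisj, hnew, mul_one]
  refine prod_congr rfl fun c hc => ?_
  have h₁ : c.2 < σ.rowLen c.1 := mem_iff_lt_rowLen.1 hc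
  have h₂ : c.1 < σ.colLen c.2 := mem_iff_lt_colLen.1 hc
  rw [hookLength, hookLength, hrow, hcol]
  omega

end Extensions

section Pairings

variable {ι α M : Type*} [DecidableEq α]

theorem prod_eq_prod_sdiff_mul_prod_pairs [CommMonoid M] {s : Finset α} {T : Finset ι}
    {φ ψ : ι → α} (hφ : Set.InjOn φ T) (hψ : Set.InjOn ψ T)
    (hdisj : Disjoint (T.image φ) (T.image ψ)) (hs : T.image φ ∪ T.image ψ ⊆ s) (f : α → M) :
    ∏ a ∈ s, f a =
      (∏ a ∈ s \ (T.image φ ∪ T.image ψ), f a) * ∏ t ∈ T, f (φ t) * f (ψ t) := by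
  rw [← prod_sdiff hs, prod_union hdisj, prod_image hφ, prod_image hψ, prod_mul_distrib]

theorem prod_eq_prod_diag_mul_prod_swap {β : Type*} [LinearOrder β] [CommMonoid M]
    {s : Finset (β × β)} (hs : ∀ c ∈ s, c.swap ∈ s) (f : β × β → M) :
    ∏ c ∈ s, f c = (∏ c ∈ s with c.1 = c.2, f c) * ∏ c ∈ s with c.2 < c.1, f c * f c.swap := by
  have habove : ∏ c ∈ s with c.1 < c.2, f c = ∏ c ∈ s with c.2 < c.1, f c.swap :=
    prod_nbij' Prod.swap Prod.swap
      (fun c hc => mem_filter.2 ⟨hs c (mem_filter.1 hc).1, (mem_filter.1 hc).2⟩)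
      (fun c hc => mem_filter.2 ⟨hs c (mem_filter.1 hc).1, (mem_filter.1 hc).2⟩)
      (fun c _ => c.swap_swap) (fun c _ => c.swap_swap) (fun c _ => by rw [c.swap_swap])
  have hoff : {c ∈ s | ¬c.1 = c.2} = {c ∈ s | c.2 < c.1} ∪ {c ∈ s | c.1 < c.2} := by
    rw [← filter_or]
    exact filter_congr fun c _ => ne_iff_lt_or_gt.trans or_comm
  have hdisj : Disjoint {c ∈ s | c.2 < c.1} {c ∈ s | c.1 < c.2} :=
    disjoint_filter.2 fun c _ h => h.not_gt
  rw [← prod_filter_mul_prod_filter_not s fun c => c.1 = c.2, hoff, prod_union hdisj, habove,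
    prod_mul_distrib]

end Pairings

section Comparison

variable {σ : YoungDiagram}

theorem swap_mem_of_isSymmetric (hσ : σ.IsSymmetric) {c : ℕ × ℕ} (hc : c ∈ σ) : c.swap ∈ σ :=
  mem_transpose.1 (hσ.symm ▸ hc)

theorem colLen_eq_rowLen_of_isSymmetric (hσ : σ.IsSymmetric) (i : ℕ) : σ.colLen i = σ.rowLen i := by
  rw [← rowLen_transpose, hσ]

theorem hookLength_swap (hσ : σ.IsSymmetric) (c : ℕ × ℕ) :
    hookLength σ c.swap = hookLength σ c := by
  simp only [hookLength, Prod.fst_swap, Prod.snd_swap, colLen_eq_rowLen_of_isSymmetric hσ]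
  omega

/-- The box `c` can be added to `σ` and lies above the diagonal. -/
def IsAddableAbove (σ : YoungDiagram) (c : ℕ × ℕ) : Prop :=
  IsAddable σ c ∧ c.2 < c.1

theorem IsAddable.swap (hσ : σ.IsSymmetric) {c : ℕ × ℕ} (h : IsAddable σ c) :
    IsAddable σ c.swap :=
  ⟨h.2.trans (colLen_eq_rowLen_of_isSymmetric hσ _),
    h.1.trans (colLen_eq_rowLen_of_isSymmetric hσ _).symm⟩

namespace IsAddableAbove

variable {k l : ℕ × ℕ}

theorem eq_of_fst_eq (hk : IsAddableAbove σ k) (hl : IsAddableAbove σ l) (h : k.1 = l.1) : k = l :=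
  Prod.ext h (by rw [hk.1.1, hl.1.1, h])

theorem eq_of_snd_eq (hk : IsAddableAbove σ k) (hl : IsAddableAbove σ l) (h : k.2 = l.2) : k = l :=
  Prod.ext (by rw [hk.1.2, hl.1.2, h]) h

theorem fst_ne_snd (hσ : σ.IsSymmetric) (hk : IsAddableAbove σ k) (hl : IsAddableAbove σ l) :
    k.1 ≠ l.2 := fun h => by
  have hkl : k.2 = l.1 := by rw [hk.1.1, hl.1.2, h, colLen_eq_rowLen_of_isSymmetric hσ]
  have hk₂ := hk.2
  have hl₂ := hl.2
  omega

theorem mk_fst_snd_mem (hk : IsAddableAbove σ k) (h : l.2 < k.2) : (k.1, l.2) ∈ σ :=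
  mem_iff_lt_rowLen.2 (h.trans_eq hk.1.1)

theorem mk_snd_snd_mem (hk : IsAddableAbove σ k) (h : l.2 < k.2) : (k.2, l.2) ∈ σ :=
  σ.up_left_mem hk.2.le le_rfl (hk.mk_fst_snd_mem h)

variable {B : Finset (ℕ × ℕ)}

theorem rowCount_fst (hB : ∀ b ∈ B, IsAddableAbove σ b) (hk : IsAddableAbove σ k) :
    rowCount B k.1 = if k ∈ B then 1 else 0 := by
  rw [rowCount, filter_congr fun b hb => ⟨(hB b hb).eq_of_fst_eq hk, congrArg Prod.fst⟩,
    filter_eq', apply_ite card, card_singleton, card_empty]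

theorem colCount_snd (hB : ∀ b ∈ B, IsAddableAbove σ b) (hk : IsAddableAbove σ k) :
    colCount B k.2 = if k ∈ B then 1 else 0 := by
  rw [colCount, filter_congr fun b hb => ⟨(hB b hb).eq_of_snd_eq hk, congrArg Prod.snd⟩,
    filter_eq', apply_ite card, card_singleton, card_empty]

theorem rowCount_snd (hσ : σ.IsSymmetric) (hB : ∀ b ∈ B, IsAddableAbove σ b)
    (hk : IsAddableAbove σ k) : rowCount B k.2 = 0 :=
  card_eq_zero.2 (filter_eq_empty_iff.2 fun b hb => (hB b hb).fst_ne_snd hσ hk)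

theorem colCount_fst (hσ : σ.IsSymmetric) (hB : ∀ b ∈ B, IsAddableAbove σ b)
    (hk : IsAddableAbove σ k) : colCount B k.1 = 0 :=
  card_eq_zero.2 (filter_eq_empty_iff.2 fun b hb => (hk.fst_ne_snd hσ (hB b hb)).symm)

end IsAddableAbove

/-- The product of the hook lengths that the cell `c` of `σ` and its mirror image acquire when the
boxes of `B` are added to `σ`. -/
def mirrorProd (σ : YoungDiagram) (B : Finset (ℕ × ℕ)) (c : ℕ × ℕ) : ℕ :=
  (hookLength σ c + rowCount B c.1 + colCount B c.2) *
    (hookLength σ c.swap + rowCount B c.2 + colCount B c.1)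

theorem mirrorProd_pos (B : Finset (ℕ × ℕ)) (c : ℕ × ℕ) : 0 < mirrorProd σ B c := by
  have := hookLength_pos σ c
  have := hookLength_pos σ c.swap
  unfold mirrorProd
  positivity

end Comparison

section CrossPairs

/-- The number of boxes of `B` in row `i` minus the number of boxes of `B` in column `i`. -/
def rowExcess (B : Finset (ℕ × ℕ)) (i : ℕ) : ℤ :=
  rowCount B i - colCount B i

/-- The amount by which `mirrorProd` at the cell `c` changes when `V` is replaced by its mirror
image in `U ∪ V` (see `mirrorProd_union_add_excessProd`). -/
def excessProd (U V : Finset (ℕ × ℕ)) (c : ℕ × ℕ) : ℤ :=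
  (rowExcess U c.1 - rowExcess U c.2) * (rowExcess V c.1 - rowExcess V c.2)

/-- The pairs consisting of a box of `U` and a box of `V`, in the order in which the second box lies
in the smaller column. -/
def crossPairs (U V : Finset (ℕ × ℕ)) : Finset ((ℕ × ℕ) × (ℕ × ℕ)) :=
  {t ∈ U ×ˢ V ∪ V ×ˢ U | t.2.2 < t.1.2}

theorem mem_crossPairs {U V : Finset (ℕ × ℕ)} {k l : ℕ × ℕ} :
    (k, l) ∈ crossPairs U V ↔ (k ∈ U ∧ l ∈ V ∨ k ∈ V ∧ l ∈ U) ∧ l.2 < k.2 := by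
  rw [crossPairs, mem_filter, mem_union, mem_product, mem_product]

theorem exists_mem_of_rowExcess_ne_zero {B : Finset (ℕ × ℕ)} {i : ℕ} (h : rowExcess B i ≠ 0) :
    ∃ b ∈ B, b.1 = i ∨ b.2 = i := by
  contrapose! h
  rw [rowExcess, rowCount, colCount, filter_false_of_mem fun b hb => (h b hb).1,
    filter_false_of_mem fun b hb => (h b hb).2, sub_self]

variable {σ : YoungDiagram}

theorem IsAddableAbove.rowExcess_fst {B : Finset (ℕ × ℕ)} {k : ℕ × ℕ} (hσ : σ.IsSymmetric)
    (hB : ∀ b ∈ B, IsAddableAbove σ b) (hk : IsAddableAbove σ k) :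
    rowExcess B k.1 = if k ∈ B then 1 else 0 := by
  rw [rowExcess, hk.rowCount_fst hB, hk.colCount_fst hσ hB]
  push_cast
  rw [sub_zero]

theorem IsAddableAbove.rowExcess_snd {B : Finset (ℕ × ℕ)} {k : ℕ × ℕ} (hσ : σ.IsSymmetric)
    (hB : ∀ b ∈ B, IsAddableAbove σ b) (hk : IsAddableAbove σ k) :
    rowExcess B k.2 = -if k ∈ B then 1 else 0 := by
  rw [rowExcess, hk.rowCount_snd hσ hB, hk.colCount_snd hB]
  push_cast
  rw [zero_sub]

theorem exists_mem_of_rowExcess_sub_ne_zero {B : Finset (ℕ × ℕ)} {c : ℕ × ℕ}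
    (hB : ∀ b ∈ B, IsAddableAbove σ b) (hc : c ∈ σ) (hlt : c.2 < c.1)
    (h : rowExcess B c.1 - rowExcess B c.2 ≠ 0) :
    ∃ b ∈ B, b.1 = c.1 ∨ b.2 = c.1 ∨ b.2 = c.2 := by
  rcases ne_or_eq (rowExcess B c.1) 0 with h₁ | h₁
  · obtain ⟨b, hb, hbc⟩ := exists_mem_of_rowExcess_ne_zero h₁
    exact ⟨b, hb, hbc.imp_right Or.inl⟩
  have h₂ : rowExcess B c.2 ≠ 0 := fun h₂ => h (by rw [h₁, h₂, sub_zero])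
  obtain ⟨b, hb, hbc | hbc⟩ := exists_mem_of_rowExcess_ne_zero h₂
  · have hbσ : b ∈ σ := σ.up_left_mem (hbc.trans_lt hlt).le ((hB b hb).2.trans_eq hbc).le hc
    exact absurd hbσ (hB b hb).1.notMem
  · exact ⟨b, hb, Or.inr (Or.inr hbc)⟩

theorem mirrorProd_fst_snd {B : Finset (ℕ × ℕ)} {k l : ℕ × ℕ} (hσ : σ.IsSymmetric)
    (hB : ∀ b ∈ B, IsAddableAbove σ b) (hk : k ∈ B) (hl : l ∈ B) :
    mirrorProd σ B (k.1, l.2) = hookLength σ (k.1, l.2) * (hookLength σ (k.1, l.2) + 2) := by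
  rw [mirrorProd, hookLength_swap hσ, (hB k hk).rowCount_fst hB, (hB l hl).colCount_snd hB,
    (hB l hl).rowCount_snd hσ hB, (hB k hk).colCount_fst hσ hB, if_pos hk, if_pos hl]
  ring

theorem mirrorProd_snd_snd {B : Finset (ℕ × ℕ)} {k l : ℕ × ℕ} (hσ : σ.IsSymmetric)
    (hB : ∀ b ∈ B, IsAddableAbove σ b) (hk : k ∈ B) (hl : l ∈ B) :
    mirrorProd σ B (k.2, l.2) = (hookLength σ (k.2, l.2) + 1) ^ 2 := by
  rw [mirrorProd, hookLength_swap hσ, (hB k hk).rowCount_snd hσ hB, (hB l hl).colCount_snd hB,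
    (hB l hl).rowCount_snd hσ hB, (hB k hk).colCount_snd hB, if_pos hk, if_pos hl]
  ring

variable {U V : Finset (ℕ × ℕ)}

theorem mirrorProd_union_add_excessProd (hσ : σ.IsSymmetric) (hUV : Disjoint U V)
    (hUV' : Disjoint U (V.image Prod.swap)) (c : ℕ × ℕ) :
    mirrorProd σ (U ∪ V) c + excessProd U V c = mirrorProd σ (U ∪ V.image Prod.swap) c := by
  simp only [mirrorProd, excessProd, rowExcess, hookLength_swap hσ, rowCount_union hUV,
    colCount_union hUV, rowCount_union hUV', colCount_union hUV', rowCount_image_swap,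
    colCount_image_swap]
  push_cast
  ring

variable (hσ : σ.IsSymmetric) (hU : ∀ b ∈ U, IsAddableAbove σ b)
  (hV : ∀ b ∈ V, IsAddableAbove σ b) (hUV : Disjoint U V)

section Pair

variable {k l : ℕ × ℕ} (hkl : (k, l) ∈ crossPairs U V)

include hU hV hkl

theorem isAddableAbove_of_mem_crossPairs : IsAddableAbove σ k ∧ IsAddableAbove σ l := by
  rcases (mem_crossPairs.1 hkl).1 with ⟨hk, hl⟩ | ⟨hk, hl⟩
  · exact ⟨hU k hk, hV l hl⟩
  · exact ⟨hV k hk, hU l hl⟩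

include hσ hUV

theorem excessProd_fst_snd : excessProd U V (k.1, l.2) = 1 := by
  obtain ⟨hk, hl⟩ := isAddableAbove_of_mem_crossPairs hU hV hkl
  simp only [excessProd, hk.rowExcess_fst hσ hU, hk.rowExcess_fst hσ hV, hl.rowExcess_snd hσ hU,
    hl.rowExcess_snd hσ hV]
  rcases (mem_crossPairs.1 hkl).1 with ⟨hk, hl⟩ | ⟨hk, hl⟩
  · simp [hk, hl, disjoint_left.1 hUV hk, disjoint_right.1 hUV hl]
  · simp [hk, hl, disjoint_right.1 hUV hk, disjoint_left.1 hUV hl]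

theorem excessProd_snd_snd : excessProd U V (k.2, l.2) = -1 := by
  obtain ⟨hk, hl⟩ := isAddableAbove_of_mem_crossPairs hU hV hkl
  simp only [excessProd, hk.rowExcess_snd hσ hU, hk.rowExcess_snd hσ hV, hl.rowExcess_snd hσ hU,
    hl.rowExcess_snd hσ hV]
  rcases (mem_crossPairs.1 hkl).1 with ⟨hk, hl⟩ | ⟨hk, hl⟩
  · simp [hk, hl, disjoint_left.1 hUV hk, disjoint_right.1 hUV hl]
  · simp [hk, hl, disjoint_right.1 hUV hk, disjoint_left.1 hUV hl]

theorem mirrorProd_union_mul_lt_of_mem_crossPairs (hUV' : Disjoint U (V.image Prod.swap)) :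
    mirrorProd σ (U ∪ V) (k.1, l.2) * mirrorProd σ (U ∪ V) (k.2, l.2) <
      mirrorProd σ (U ∪ V.image Prod.swap) (k.1, l.2) *
        mirrorProd σ (U ∪ V.image Prod.swap) (k.2, l.2) := by
  have hk := (isAddableAbove_of_mem_crossPairs hU hV hkl).1
  have hlk : l.2 < k.2 := (mem_crossPairs.1 hkl).2
  have hB : ∀ b ∈ U ∪ V, IsAddableAbove σ b := fun b hb => (mem_union.1 hb).elim (hU b) (hV b)
  have hkB : k ∈ U ∪ V := mem_union.2 ((mem_crossPairs.1 hkl).1.imp And.left And.left)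
  have hlB : l ∈ U ∪ V := mem_union.2 ((mem_crossPairs.1 hkl).1.imp And.right And.right).symm
  have hfst := mirrorProd_union_add_excessProd hσ hUV hUV' (k.1, l.2)
  have hsnd := mirrorProd_union_add_excessProd hσ hUV hUV' (k.2, l.2)
  rw [mirrorProd_fst_snd hσ hB hkB hlB, excessProd_fst_snd hσ hU hV hUV hkl] at hfst
  rw [mirrorProd_snd_snd hσ hB hkB hlB, excessProd_snd_snd hσ hU hV hUV hkl] at hsnd
  have hlt : hookLength σ (k.1, l.2) < hookLength σ (k.2, l.2) :=
    hookLength_lt_hookLength (Prod.mk_lt_mk_iff_left.2 hk.2) (hk.mk_fst_snd_mem hlk)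
  rw [mirrorProd_fst_snd hσ hB hkB hlB, mirrorProd_snd_snd hσ hB hkB hlB]
  zify at hlt ⊢
  rw [← hfst, ← hsnd]
  push_cast
  have hsq : ((hookLength σ (k.1, l.2) : ℤ) + 1) ^ 2 < (hookLength σ (k.2, l.2) + 1) ^ 2 := by
    gcongr
  linear_combination hsq

end Pair

include hσ hU hV hUV in
theorem exists_mem_crossPairs_of_excessProd_ne_zero {c : ℕ × ℕ} (hc : c ∈ σ) (hlt : c.2 < c.1)
    (h : excessProd U V c ≠ 0) :
    ∃ k l, (k, l) ∈ crossPairs U V ∧ (c = (k.1, l.2) ∨ c = (k.2, l.2)) := by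
  have hcross : ∀ k l : ℕ × ℕ, (k ∈ U ∧ l ∈ V ∨ k ∈ V ∧ l ∈ U) → IsAddableAbove σ k →
      (k.1 = c.1 ∨ k.2 = c.1) → l.2 = c.2 →
      ∃ k l, (k, l) ∈ crossPairs U V ∧ (c = (k.1, l.2) ∨ c = (k.2, l.2)) := by
    rintro k l hkl hk (hk₁ | hk₂) hl₂
    · have hc₂ : c.2 < k.2 := by rw [hk.1.1, hk₁]; exact mem_iff_lt_rowLen.1 hc
      exact ⟨k, l, mem_crossPairs.2 ⟨hkl, hl₂ ▸ hc₂⟩, Or.inl (Prod.ext hk₁.symm hl₂.symm)⟩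
    · exact ⟨k, l, mem_crossPairs.2 ⟨hkl, by rwa [hl₂, hk₂]⟩, Or.inr (Prod.ext hk₂.symm hl₂.symm)⟩
  obtain ⟨h₁, h₂⟩ := mul_ne_zero_iff.1 h
  obtain ⟨k, hk, hkc⟩ := exists_mem_of_rowExcess_sub_ne_zero hU hc hlt h₁
  obtain ⟨l, hl, hlc⟩ := exists_mem_of_rowExcess_sub_ne_zero hV hc hlt h₂
  have hne : k ≠ l := fun hkl => disjoint_left.1 hUV hk (hkl ▸ hl)
  rcases hkc with hk₁ | hk₁ | hk₁ <;> rcases hlc with hl₁ | hl₁ | hl₁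
  · exact absurd ((hU k hk).eq_of_fst_eq (hV l hl) (hk₁.trans hl₁.symm)) hne
  · exact absurd (hk₁.trans hl₁.symm) ((hU k hk).fst_ne_snd hσ (hV l hl))
  · exact hcross k l (Or.inl ⟨hk, hl⟩) (hU k hk) (Or.inl hk₁) hl₁
  · exact absurd (hl₁.trans hk₁.symm) ((hV l hl).fst_ne_snd hσ (hU k hk))
  · exact absurd ((hU k hk).eq_of_snd_eq (hV l hl) (hk₁.trans hl₁.symm)) hne
  · exact hcross k l (Or.inl ⟨hk, hl⟩) (hU k hk) (Or.inr hk₁) hl₁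
  · exact hcross l k (Or.inr ⟨hl, hk⟩) (hV l hl) (Or.inl hl₁) hk₁
  · exact hcross l k (Or.inr ⟨hl, hk⟩) (hV l hl) (Or.inr hl₁) hk₁
  · exact absurd ((hU k hk).eq_of_snd_eq (hV l hl) (hk₁.trans hl₁.symm)) hne

end CrossPairs

section HookProducts

variable {σ ν ν' : YoungDiagram} {U V : Finset (ℕ × ℕ)}

theorem hookProd_eq_prod_diag_mul_prod_mirrorProd {B : Finset (ℕ × ℕ)} (hσ : σ.IsSymmetric)
    (hB : ∀ b ∈ B, IsAddable σ b) (hν : ν.cells = σ.cells ∪ B) :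
    hookProd ν =
      (∏ c ∈ σ.cells with c.1 = c.2, (hookLength σ c + (rowCount B c.1 + colCount B c.1))) *
        ∏ c ∈ σ.cells with c.2 < c.1, mirrorProd σ B c := by
  rw [hookProd_of_cells_eq_union hB hν,
    prod_eq_prod_diag_mul_prod_swap fun c hc => swap_mem_of_isSymmetric hσ hc]
  congr 1
  refine prod_congr rfl fun c hc => ?_
  rw [← (mem_filter.1 hc).2, add_assoc]

theorem rowCount_add_colCount_union_image_swap (hUV : Disjoint U V)
    (hUV' : Disjoint U (V.image Prod.swap)) (i : ℕ) :
    rowCount (U ∪ V.image Prod.swap) i + colCount (U ∪ V.image Prod.swap) i =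
      rowCount (U ∪ V) i + colCount (U ∪ V) i := by
  rw [rowCount_union hUV', colCount_union hUV', rowCount_union hUV, colCount_union hUV,
    rowCount_image_swap, colCount_image_swap]
  ring

theorem disjoint_image_swap_of_isAddableAbove (hU : ∀ b ∈ U, IsAddableAbove σ b)
    (hV : ∀ b ∈ V, IsAddableAbove σ b) : Disjoint U (V.image Prod.swap) := by
  refine disjoint_right.2 fun c hc hcU => ?_
  obtain ⟨b, hb, rfl⟩ := mem_image.1 hc
  exact (hV b hb).2.asymm (hU _ hcU).2

variable (hσ : σ.IsSymmetric) (hU : ∀ b ∈ U, IsAddableAbove σ b)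
  (hV : ∀ b ∈ V, IsAddableAbove σ b)

section

include hU hV

theorem isAddable_of_mem_union : ∀ b ∈ U ∪ V, IsAddable σ b := fun b hb =>
  (mem_union.1 hb).elim (fun hb => (hU b hb).1) fun hb => (hV b hb).1

include hσ in
theorem isAddable_of_mem_union_image_swap : ∀ b ∈ U ∪ V.image Prod.swap, IsAddable σ b := by
  intro c hc
  rcases mem_union.1 hc with hc | hc
  · exact (hU c hc).1
  · obtain ⟨b, hb, rfl⟩ := mem_image.1 hc
    exact (hV b hb).1.swap hσ

theorem injOn_fst_snd_crossPairs :
    Set.InjOn (fun t : (ℕ × ℕ) × (ℕ × ℕ) => (t.1.1, t.2.2)) (crossPairs U V) := by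
  rintro ⟨k, l⟩ hkl ⟨k', l'⟩ hkl' h
  obtain ⟨hk, hl⟩ := isAddableAbove_of_mem_crossPairs hU hV hkl
  obtain ⟨hk', hl'⟩ := isAddableAbove_of_mem_crossPairs hU hV hkl'
  exact Prod.ext (hk.eq_of_fst_eq hk' (Prod.ext_iff.1 h).1)
    (hl.eq_of_snd_eq hl' (Prod.ext_iff.1 h).2)

theorem injOn_snd_snd_crossPairs :
    Set.InjOn (fun t : (ℕ × ℕ) × (ℕ × ℕ) => (t.1.2, t.2.2)) (crossPairs U V) := by
  rintro ⟨k, l⟩ hkl ⟨k', l'⟩ hkl' h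
  obtain ⟨hk, hl⟩ := isAddableAbove_of_mem_crossPairs hU hV hkl
  obtain ⟨hk', hl'⟩ := isAddableAbove_of_mem_crossPairs hU hV hkl'
  exact Prod.ext (hk.eq_of_snd_eq hk' (Prod.ext_iff.1 h).1)
    (hl.eq_of_snd_eq hl' (Prod.ext_iff.1 h).2)

include hσ in
theorem disjoint_image_fst_snd_image_snd_snd :
    Disjoint ((crossPairs U V).image fun t => (t.1.1, t.2.2))
      ((crossPairs U V).image fun t => (t.1.2, t.2.2)) := by
  simp only [disjoint_left, mem_image, not_exists, not_and]
  rintro _ ⟨⟨k, l⟩, hkl, rfl⟩ ⟨k', l'⟩ hkl' h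
  exact (isAddableAbove_of_mem_crossPairs hU hV hkl).1.fst_ne_snd hσ
    (isAddableAbove_of_mem_crossPairs hU hV hkl').1 (Prod.ext_iff.1 h).1.symm

theorem image_fst_snd_union_image_snd_snd_subset :
    ((crossPairs U V).image fun t => (t.1.1, t.2.2)) ∪
      ((crossPairs U V).image fun t => (t.1.2, t.2.2)) ⊆ {c ∈ σ.cells | c.2 < c.1} := by
  have hcells : ∀ t ∈ crossPairs U V, (t.1.1, t.2.2) ∈ {c ∈ σ.cells | c.2 < c.1} ∧
      (t.1.2, t.2.2) ∈ {c ∈ σ.cells | c.2 < c.1} := fun t ht => by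
    have hk := (isAddableAbove_of_mem_crossPairs hU hV ht).1
    have hlk := (mem_crossPairs.1 ht).2
    exact ⟨mem_filter.2 ⟨hk.mk_fst_snd_mem hlk, hlk.trans hk.2⟩,
      mem_filter.2 ⟨hk.mk_snd_snd_mem hlk, hlk⟩⟩
  exact union_subset (image_subset_iff.2 fun t ht => (hcells t ht).1)
    (image_subset_iff.2 fun t ht => (hcells t ht).2)

end

variable (hUV : Disjoint U V)

include hσ hU hV hUV

theorem mirrorProd_union_image_swap_of_notMem {c : ℕ × ℕ} (hc : c ∈ σ) (hlt : c.2 < c.1)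
    (hcross : c ∉ ((crossPairs U V).image fun t => (t.1.1, t.2.2)) ∪
      (crossPairs U V).image fun t => (t.1.2, t.2.2)) :
    mirrorProd σ (U ∪ V.image Prod.swap) c = mirrorProd σ (U ∪ V) c := by
  have hzero : excessProd U V c = 0 := by
    contrapose! hcross
    obtain ⟨k, l, hkl, rfl | rfl⟩ :=
      exists_mem_crossPairs_of_excessProd_ne_zero hσ hU hV hUV hc hlt hcross
    · exact mem_union_left _ (mem_image_of_mem (fun t => (t.1.1, t.2.2)) hkl)
    · exact mem_union_right _ (mem_image_of_mem (fun t => (t.1.2, t.2.2)) hkl)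
  have h := mirrorProd_union_add_excessProd hσ hUV (disjoint_image_swap_of_isAddableAbove hU hV) c
  rw [hzero, add_zero] at h
  exact_mod_cast h.symm

variable (hν : ν.cells = σ.cells ∪ (U ∪ V.image Prod.swap)) (hν' : ν'.cells = σ.cells ∪ (U ∪ V))

include hν hν'

theorem card_eq_card_of_cells_eq_union_image_swap : ν'.card = ν.card := by
  rw [YoungDiagram.card, YoungDiagram.card, hν, hν',
    card_union_of_disjoint
      (disjoint_cells_of_isAddable (isAddable_of_mem_union_image_swap hσ hU hV)),
    card_union_of_disjoint (disjoint_cells_of_isAddable (isAddable_of_mem_union hU hV)),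
    card_union_of_disjoint hUV,
    card_union_of_disjoint (disjoint_image_swap_of_isAddableAbove hU hV),
    card_image_of_injective _ Prod.swap_injective]

theorem exists_hookProd_eq_mul_prod_crossPairs : ∃ m > 0,
    hookProd ν = m * ∏ t ∈ crossPairs U V, mirrorProd σ (U ∪ V.image Prod.swap) (t.1.1, t.2.2) *
      mirrorProd σ (U ∪ V.image Prod.swap) (t.1.2, t.2.2) ∧
    hookProd ν' = m * ∏ t ∈ crossPairs U V, mirrorProd σ (U ∪ V) (t.1.1, t.2.2) *
      mirrorProd σ (U ∪ V) (t.1.2, t.2.2) := by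
  have hswap := disjoint_image_swap_of_isAddableAbove hU hV
  have hadd := isAddable_of_mem_union_image_swap hσ hU hV
  have hadd' := isAddable_of_mem_union hU hV
  have hsplit := prod_eq_prod_sdiff_mul_prod_pairs (M := ℕ) (injOn_fst_snd_crossPairs hU hV)
    (injOn_snd_snd_crossPairs hU hV) (disjoint_image_fst_snd_image_snd_snd hσ hU hV)
    (image_fst_snd_union_image_snd_snd_subset hU hV)
  rw [hookProd_eq_prod_diag_mul_prod_mirrorProd hσ hadd hν, hsplit,
    hookProd_eq_prod_diag_mul_prod_mirrorProd hσ hadd' hν', hsplit]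
  refine ⟨_, ?_, (mul_assoc _ _ _).symm, ?_⟩
  · exact Nat.mul_pos (prod_pos fun c _ => Nat.add_pos_left (hookLength_pos σ c) _)
      (prod_pos fun c _ => mirrorProd_pos _ c)
  · rw [← mul_assoc]
    simp only [rowCount_add_colCount_union_image_swap hUV hswap]
    congr 2
    refine prod_congr rfl fun c hc => ?_
    obtain ⟨hc, hcross⟩ := mem_sdiff.1 hc
    obtain ⟨hcσ, hlt⟩ := mem_filter.1 hc
    exact (mirrorProd_union_image_swap_of_notMem hσ hU hV hUV hcσ hlt hcross).symm

theorem hookProd_union_le_hookProd_union_image_swap : hookProd ν' ≤ hookProd ν := by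
  obtain ⟨m, -, hm, hm'⟩ := exists_hookProd_eq_mul_prod_crossPairs hσ hU hV hUV hν hν'
  rw [hm, hm']
  exact Nat.mul_le_mul_left _ (prod_le_prod' fun t ht =>
    (mirrorProd_union_mul_lt_of_mem_crossPairs hσ hU hV hUV ht
      (disjoint_image_swap_of_isAddableAbove hU hV)).le)

theorem hookProd_union_lt_hookProd_union_image_swap (hU₀ : U.Nonempty) (hV₀ : V.Nonempty) :
    hookProd ν' < hookProd ν := by
  obtain ⟨m, hm₀, hm, hm'⟩ := exists_hookProd_eq_mul_prod_crossPairs hσ hU hV hUV hν hν'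
  have hne : (crossPairs U V).Nonempty := by
    obtain ⟨⟨k, hk⟩, ⟨l, hl⟩⟩ := And.intro hU₀ hV₀
    have hkl : k.2 ≠ l.2 := fun h =>
      disjoint_left.1 hUV hk ((hU k hk).eq_of_snd_eq (hV l hl) h ▸ hl)
    rcases hkl.lt_or_gt with h | h
    · exact ⟨(l, k), mem_crossPairs.2 ⟨Or.inr ⟨hl, hk⟩, h⟩⟩
    · exact ⟨(k, l), mem_crossPairs.2 ⟨Or.inl ⟨hk, hl⟩, h⟩⟩
  rw [hm, hm']
  exact Nat.mul_lt_mul_of_pos_left (prod_lt_prod_of_nonempty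
    (fun t _ => Nat.mul_pos (mirrorProd_pos _ _) (mirrorProd_pos _ _))
    (fun t ht => mirrorProd_union_mul_lt_of_mem_crossPairs hσ hU hV hUV ht
      (disjoint_image_swap_of_isAddableAbove hU hV)) hne) hm₀

end HookProducts

section Reflection

variable {μ : YoungDiagram} {c : ℕ × ℕ}

theorem mem_baseSubdiagram : c ∈ μ.baseSubdiagram ↔ c ∈ μ ∧ c.swap ∈ μ := by
  rw [baseSubdiagram, mem_inf, mem_transpose]

theorem mem_asymBoxes : c ∈ μ.asymBoxes ↔ c ∈ μ ∧ c.swap ∉ μ := by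
  rw [asymBoxes, mem_sdiff, mem_cells, mem_cells, mem_baseSubdiagram]
  tauto

theorem cells_eq_baseSubdiagram_union_asymBoxes (μ : YoungDiagram) :
    μ.cells = μ.baseSubdiagram.cells ∪ μ.asymBoxes :=
  (union_sdiff_of_subset inf_le_left).symm

theorem asymBoxes_eq_asymAbove_union_asymBelow (μ : YoungDiagram) :
    μ.asymBoxes = μ.asymAbove ∪ μ.asymBelow := by
  rw [asymAbove, asymBelow, ← filter_or, filter_true_of_mem]
  intro c hc
  obtain ⟨hmem, hswap⟩ := mem_asymBoxes.1 hc
  refine lt_or_gt_of_ne fun h => hswap ?_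
  rwa [show c.swap = c from Prod.ext h h.symm]

theorem disjoint_asymAbove_image_swap_asymBelow (μ : YoungDiagram) :
    Disjoint μ.asymAbove (μ.asymBelow.image Prod.swap) := by
  refine disjoint_right.2 fun c hc hc' => ?_
  obtain ⟨b, hb, rfl⟩ := mem_image.1 hc
  exact (mem_asymBoxes.1 (mem_filter.1 hb).1).2 (mem_asymBoxes.1 (mem_filter.1 hc').1).1

theorem image_swap_image_swap (B : Finset (ℕ × ℕ)) : (B.image Prod.swap).image Prod.swap = B := by
  rw [image_image, Prod.swap_swap_eq, image_id]

theorem isSymmetric_baseSubdiagram (μ : YoungDiagram) : μ.baseSubdiagram.IsSymmetric :=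
  (isGreatest_baseSubdiagram μ).1.1

section

variable (hrow : ∀ i, rowCount μ.asymBoxes i ≤ 1) (hcol : ∀ j, colCount μ.asymBoxes j ≤ 1)

include hrow hcol

theorem isAddable_baseSubdiagram_of_mem_asymBoxes (hc : c ∈ μ.asymBoxes) :
    IsAddable μ.baseSubdiagram c :=
  isAddable_of_count_le_one disjoint_sdiff (cells_eq_baseSubdiagram_union_asymBoxes μ) hrow hcol hc

theorem isAddableAbove_of_mem_asymAbove : ∀ b ∈ μ.asymAbove, IsAddableAbove μ.baseSubdiagram b :=
  fun _ hb => ⟨isAddable_baseSubdiagram_of_mem_asymBoxes hrow hcol (mem_filter.1 hb).1,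
    (mem_filter.1 hb).2⟩

theorem isAddableAbove_of_mem_image_swap_asymBelow :
    ∀ b ∈ μ.asymBelow.image Prod.swap, IsAddableAbove μ.baseSubdiagram b := by
  intro c hc
  obtain ⟨b, hb, rfl⟩ := mem_image.1 hc
  exact ⟨(isAddable_baseSubdiagram_of_mem_asymBoxes hrow hcol (mem_filter.1 hb).1).swap
    (isSymmetric_baseSubdiagram μ), (mem_filter.1 hb).2⟩

end

end Reflection

end YoungTableaux

open YoungTableaux in
theorem mainTheorem1 (μ : YoungDiagram)
    (hrow : ∀ i : ℕ, (μ.asymBoxes.filter fun c => c.1 = i).card ≤ 1)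
    (hcol : ∀ j : ℕ, (μ.asymBoxes.filter fun c => c.2 = j).card ≤ 1) :
    ∃ μ' : YoungDiagram,
      μ'.cells = μ.baseSubdiagram.cells ∪ μ.asymAbove ∪ μ.asymBelow.image Prod.swap ∧
      μ'.card = μ.card ∧
      μ.dim ≤ μ'.dim ∧
      (μ.asymAbove.Nonempty → μ.asymBelow.Nonempty → μ.dim < μ'.dim) := by
  have hσ := isSymmetric_baseSubdiagram μ
  have hU := isAddableAbove_of_mem_asymAbove hrow hcol
  have hV := isAddableAbove_of_mem_image_swap_asymBelow hrow hcol
  have hUV := disjoint_asymAbove_image_swap_asymBelow μ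
  have hμ : μ.cells = μ.baseSubdiagram.cells ∪
      (μ.asymAbove ∪ (μ.asymBelow.image Prod.swap).image Prod.swap) := by
    rw [image_swap_image_swap, ← asymBoxes_eq_asymAbove_union_asymBelow,
      ← cells_eq_baseSubdiagram_union_asymBoxes]
  obtain ⟨μ', hμ'⟩ := exists_cells_eq_union (isAddable_of_mem_union hU hV)
  have hcard := card_eq_card_of_cells_eq_union_image_swap hσ hU hV hUV hμ hμ'
  exact ⟨μ', by rw [hμ', Finset.union_assoc], hcard,
    dim_le_dim_of_hookProd_le hcard
      (hookProd_union_le_hookProd_union_image_swap hσ hU hV hUV hμ hμ'),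
    fun hU₀ hV₀ => dim_lt_dim_of_hookProd_lt hcard
      (hookProd_union_lt_hookProd_union_image_swap hσ hU hV hUV hμ hμ' hU₀ (hV₀.image _))⟩
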